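/- Let $n\ge 0$ and $N=n(n+1)/2$, and let $\mathbf i=(i_1,\dots,i_N)\in\{1,\dots,n\}^N$ be a reduced word of the longest element $w_0$ of $\mathfrak S_{n+1}$, i.e. $s_{i_1}\cdots s_{i_N}=w_0$ with $s_c=(c,c+1)$. *Rigorous paths.* The wiring diagram $G(\mathbf i)$ consists of $n+1$ wires $\ell_1,\dots,\ell_{n+1}$, in this order from left to right at the top, with crossings (nodes) $t_1,\dots,t_N$ from top to bottom, where at $t_j$ the wires in positions $i_j$ and $i_j+1$ cross ($t_j$ is in column $i_j$); $L_r$ is the lower end of $\ell_r$. For $1\le k\le n$ let $G(\mathbf i,k)$ be $G(\mathbf i)$ with $\ell_1,\dots,\ell_k$ oriented upward and $\ell_{k+1},\dots,\ell_{n+1}$ downward. A rigorous path is, for some $k$, an oriented path in $G(\mathbf i,k)$ from $L_k$ to $L_{k+1}$ that passes through each node at most once and never stays on a wire $\ell_a$ while crossing a wire $\ell_b$ with $a>b$ and both oriented downward, or with $a<b$ and both oriented upward. Let $\mathcal{GP}(\mathbf i)$ be the set of rigorous paths. *String inequalities.* For $P\in\mathcal{GP}(\mathbf i)$ this is $\sum_j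 a_jt_j\ge 0$ on $\mathbb R^N$, where $a_j=1$ (resp. $-1$) if at $t_j$ the path $P$ switches from $\ell_r$ to $\ell_s$ with $r<s$ (resp. $r>s$), and $a_j=0$ otherwise. The string cone $C_{\mathbf i}\subset\mathbb R^N$ is the set of points satisfying the string inequalities of all $P\in\mathcal{GP}(\mathbf i)$. *$\lambda$-inequalities.* Let $\lambda=\lambda_1\varpi_1+\cdots+\lambda_n\varpi_n$ with real coefficients be dominant and regular, i.e. all $\lambda_c\geq 0$ and all $\lambda_c\ne 0$. For each $j=1,\dots,N$ the $\lambda$-inequality of $t_j$ is $t_j\le\lambda_{i_j}+\sum_{k>j}a_kt_k$, where $a_k=1$ if $|i_k-i_j|=1$, $a_k=-2$ if $i_k=i_j$, and $a_k=0$ otherwise. The $\lambda$-cone $C_{\mathbf i}^\lambda$ is the set of points satisfying all of them, and the string polytope is $\Delta_{\mathbf i}(\lambda)=C_{\mathbf i}\cap C_{\mathbf i}^\lambda$. Then: 1. $C_{\mathbf i}$ is full-dimensional in $\mathbb R^N$, and its system of string inequalities, one for each $P\in\mathcal{GP}(\mathbf i)$, is non-redundant: removing any one of them changes the solution set. Sending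 each inequality to the subset of $C_{\mathbf i}$ on which it is an equality is a bijection from $\mathcal{GP}(\mathbf i)$ onto the set of facets of $C_{\mathbf i}$. 2. For every regular dominant $\lambda$, $\Delta_{\mathbf i}(\lambda)$ is full-dimensional in $\mathbb R^N$, and its system of all string inequalities (one for each $P\in\mathcal{GP}(\mathbf i)$) and all $\lambda$-inequalities (one for each of the $N$ nodes) is non-redundant: removing any one of them changes the solution set. Sending each inequality to the subset of $\Delta_{\mathbf i}(\lambda)$ on which it is an equality is a bijection from the disjoint union $\mathcal{GP}(\mathbf i)\sqcup\{1,\dots,N\}$ onto the set of facets of $\Delta_{\mathbf i}(\lambda)$. -/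

import Mathlib

namespace StringPolytope

/-! ### Systems of inequalities, redundancy and facets -/

section Polyhedra

variable {E : Type*} {ι : Type*}

/-- The set of points satisfying the system of inequalities `ρ j u ≥ 0`, `j : ι`. -/
def solutionSet (ρ : ι → E → ℝ) : Set E := {u | ∀ j, 0 ≤ ρ j u}

/-- The inequality `ρ k u ≥ 0` is redundant in `Q` if removing it from the system leaves a system
that still defines `Q`. -/
def IsRedundant (Q : Set E) (ρ : ι → E → ℝ) (k : ι) : Prop :=
  {u | ∀ j, j ≠ k → 0 ≤ ρ j u} = Q

/-- The indexed system `ρ j u ≥ 0` is a non-redundant expression of the full-dimensional set `Q`: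
it defines `Q`, and none of its inequalities can be removed. Since the system is indexed, two
indices giving the same inequality would both be redundant. -/
structure IsNonRedundantExpression [TopologicalSpace E] (Q : Set E) (ρ : ι → E → ℝ) : Prop where
  fullDimensional : (interior Q).Nonempty
  defines : Q = solutionSet ρ
  nonRedundant : ∀ k, ¬ IsRedundant Q ρ k

/-- A facet of `Q`: a nonempty exposed face of dimension one less than the dimension of `Q`. -/
def IsFacet {d : ℕ} (Q F : Set (Fin d → ℝ)) : Prop :=
  F.Nonempty ∧ IsExposed ℝ Q F ∧
    Module.finrank ℝ (vectorSpan ℝ F) + 1 = Module.finrank ℝ (vectorSpan ℝ Q)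

/-- The inequalities of the system correspond bijectively to the facets of `Q`, the inequality
`ρ j u ≥ 0` corresponding to the facet on which it is an equality. -/
def FacetsCorrespond {d : ℕ} (Q : Set (Fin d → ℝ)) (ρ : ι → (Fin d → ℝ) → ℝ) : Prop :=
  Set.BijOn (fun j => {u | u ∈ Q ∧ ρ j u = 0}) Set.univ {F | IsFacet Q F}

end Polyhedra

/-! ### Reduced words and wiring diagrams

Letters, columns and wires are numbered from `0`: the column `c : Fin n` lies between the positions
`c.castSucc` and `c.succ`, and the wire `ℓ_{r+1}` is `r : Fin (n + 1)`. Nodes are numbered from the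
top to the bottom, also from `0`. -/

/-- Words of length `N = n (n + 1) / 2` in the letters `1, …, n`. -/
abbrev Word (n : ℕ) : Type := Fin (n * (n + 1) / 2) → Fin n

/-- The simple transposition `(c, c + 1)`. -/
def simpleTransposition {n : ℕ} (c : Fin n) : Equiv.Perm (Fin (n + 1)) :=
  Equiv.swap c.castSucc c.succ

/-- `s_{i_1} ⋯ s_{i_m}`. It sends a position (from the left, below the first `m` nodes and above
the others) to the wire found there; at the top the wires are in increasing order. -/
def prefixPerm {n : ℕ} (i : Word n) (m : ℕ) : Equiv.Perm (Fin (n + 1)) :=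
  ((List.ofFn fun j => simpleTransposition (i j)).take m).prod

/-- The reduced words of the longest element `r ↦ n - r` (indices from `0`). -/
def reducedWords (n : ℕ) : Set (Word n) :=
  {i | (List.ofFn fun j => simpleTransposition (i j)).prod = Fin.revPerm}

/-- The wire `w` passes through the node `t_j`: the node `t_j` is in column `i_j`, so the two wires
crossing there are those that are in the positions `i_j` and `i_j + 1` just above it. -/
def WireThrough {n : ℕ} (i : Word n) (j : Fin (n * (n + 1) / 2)) (w : Fin (n + 1)) : Prop :=
  w = prefixPerm i j (i j).castSucc ∨ w = prefixPerm i j (i j).succ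

/-- In `G(i, k)` the wires `ℓ_1, …, ℓ_k` are oriented upward and the others downward. -/
def IsUp {n : ℕ} (k : Fin n) (w : Fin (n + 1)) : Prop := w ≤ k.castSucc

/-- `t_j` is the lowest node of the wire `w`, that is, the node next to its lower end. -/
def IsLowestNode {n : ℕ} (i : Word n) (w : Fin (n + 1)) (j : Fin (n * (n + 1) / 2)) : Prop :=
  WireThrough i j w ∧ ∀ j', WireThrough i j' w → j' ≤ j

/-- Travelling along the wire `w` in the direction it has in `G(i, k)`, the node following `t_j`
is `t_j'`. -/
def IsNextNode {n : ℕ} (i : Word n) (k : Fin n) (w : Fin (n + 1))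
    (j j' : Fin (n * (n + 1) / 2)) : Prop :=
  WireThrough i j w ∧ WireThrough i j' w ∧
    (∀ j'', WireThrough i j'' w → ¬ (min j j' < j'' ∧ j'' < max j j')) ∧
    ((IsUp k w ∧ j' < j) ∨ (¬ IsUp k w ∧ j < j'))

/-! ### Rigorous paths -/

/-- The passage of a path through a node: the node, the wire along which the path arrives, and the
wire along which it leaves. -/
structure Passage (n : ℕ) where
  node : Fin (n * (n + 1) / 2)
  inWire : Fin (n + 1)
  outWire : Fin (n + 1)

/-- The passage `p` is a forbidden fragment of `G(i, k)`: the path stays on `ℓ_a` while crossing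
`ℓ_b`, where `a > b` and both wires are oriented downward, or `a < b` and both are oriented
upward. -/
def IsForbidden {n : ℕ} (i : Word n) (k : Fin n) (p : Passage n) : Prop :=
  p.inWire = p.outWire ∧ ∃ b, WireThrough i p.node b ∧
    ((b < p.inWire ∧ ¬ IsUp k p.inWire ∧ ¬ IsUp k b) ∨
      (p.inWire < b ∧ IsUp k p.inWire ∧ IsUp k b))

/-- A rigorous path (Gleizer--Postnikov path) in `G(i, k)`, for any `k`, given by the list of its
passages through all the nodes on it, in order. -/
@[ext] structure RigorousPath {n : ℕ} (i : Word n) where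
  /-- The path runs in `G(i, k)` from `L_k` to `L_{k+1}`. -/
  k : Fin n
  passages : List (Passage n)
  wires_through : ∀ p ∈ passages, WireThrough i p.node p.inWire ∧ WireThrough i p.node p.outWire
  starts : ∃ p ∈ passages.head?, p.inWire = k.castSucc ∧ IsLowestNode i k.castSucc p.node
  ends : ∃ p ∈ passages.getLast?, p.outWire = k.succ ∧ IsLowestNode i k.succ p.node
  /-- Consecutive nodes are joined by an edge of the wiring diagram, travelled according to its
  orientation. -/
  oriented : passages.IsChain fun p q =>
    p.outWire = q.inWire ∧ IsNextNode i k p.outWire p.node q.node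
  node_at_most_once : (passages.map Passage.node).Nodup
  no_forbidden : ∀ p ∈ passages, ¬ IsForbidden i k p

/-! ### The string cone, the `λ`-cone and the string polytope -/

open Classical in
/-- The coefficient `a_j` in the string inequality of the rigorous path `P`. -/
noncomputable def stringCoeff {n : ℕ} {i : Word n} (P : RigorousPath i)
    (j : Fin (n * (n + 1) / 2)) : ℝ :=
  if ∃ p ∈ P.passages, p.node = j ∧ p.inWire < p.outWire then 1
  else if ∃ p ∈ P.passages, p.node = j ∧ p.outWire < p.inWire then -1
  else 0

/-- The string inequality of `P` is `stringForm i P t ≥ 0`. -/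
noncomputable def stringForm {n : ℕ} (i : Word n) (P : RigorousPath i)
    (t : Fin (n * (n + 1) / 2) → ℝ) : ℝ :=
  ∑ j, stringCoeff P j * t j

/-- The coefficient `a_k` of `t_k` in the `λ`-inequality of the node `t_j`, for `k > j`. -/
def lambdaCoeff {n : ℕ} (i : Word n) (j k : Fin (n * (n + 1) / 2)) : ℝ :=
  if i k = i j then -2
  else if (i k : ℕ) + 1 = i j ∨ (i j : ℕ) + 1 = i k then 1
  else 0

/-- The `λ`-inequality of `t_j`, for the weight `λ = ∑ c, lam c • ϖ_c`, is
`lambdaForm i lam j t ≥ 0`, that is `t_j ≤ λ_{i_j} + ∑_{k > j} a_k t_k`. -/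
noncomputable def lambdaForm {n : ℕ} (i : Word n) (lam : Fin n → ℝ) (j : Fin (n * (n + 1) / 2))
    (t : Fin (n * (n + 1) / 2) → ℝ) : ℝ :=
  lam (i j) + ∑ k ∈ Finset.Ioi j, lambdaCoeff i j k * t k - t j

/-- The string cone `C_i`, in its Gleizer--Postnikov description. -/
def stringCone {n : ℕ} (i : Word n) : Set (Fin (n * (n + 1) / 2) → ℝ) :=
  {t | ∀ P : RigorousPath i, 0 ≤ stringForm i P t}

/-- The `λ`-cone `C_i^λ`. -/
def lambdaCone {n : ℕ} (i : Word n) (lam : Fin n → ℝ) : Set (Fin (n * (n + 1) / 2) → ℝ) :=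
  {t | ∀ j, t j ≤ lam (i j) + ∑ k ∈ Finset.Ioi j, lambdaCoeff i j k * t k}

/-- The string polytope `Δ_i(λ)`. -/
def stringPolytope {n : ℕ} (i : Word n) (lam : Fin n → ℝ) : Set (Fin (n * (n + 1) / 2) → ℝ) :=
  stringCone i ∩ lambdaCone i lam

/-- The system of all string inequalities (one per rigorous path) and all `λ`-inequalities (one per
node). -/
noncomputable def polytopeForm {n : ℕ} (i : Word n) (lam : Fin n → ℝ) :
    RigorousPath i ⊕ Fin (n * (n + 1) / 2) → (Fin (n * (n + 1) / 2) → ℝ) → ℝ :=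
  Sum.elim (stringForm i) (lambdaForm i lam)

/-- A weight, given by its coefficients in the fundamental weights, is dominant. -/
def IsDominant {n : ℕ} (lam : Fin n → ℝ) : Prop := ∀ c, 0 ≤ lam c

/-- A weight, given by its coefficients in the fundamental weights, is regular. -/
def IsRegular {n : ℕ} (lam : Fin n → ℝ) : Prop := ∀ c, lam c ≠ 0

end StringPolytope

/-! For a finite system of affine inequalities, two kinds of points give both non-redundancy and the
bijection with facets: one point where all forms are positive, and for each inequality a point
violating it alone. The proof constructs these points.

A function `x` on the wires gives a point `wirePoint i x` whose coordinate at a node is the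
difference of `x` on the two wires crossing there. Along a rigorous path the string form telescopes,
so its value there is the jump of `x` from wire `k` to the next one (`stringForm_wirePoint`). Hence
the values of the string forms can be shifted freely, by an independent constant for each `k`. Jumps
equal to `1` give the positive point, and it remains to isolate a path among those with the same
`k`.

For this, truncate such a point at the height of `t_j`. Since forbidden fragments are excluded, the
string form at the truncated point is `0` or a sign depending only on `k` and `j`
(`stringForm_crossingPoint`). These points are unitriangular, so the values determine the string
coefficients, and these together with `k` determine the path. The paths with a given `k` thus become
distinct vertices of a cube, and each vertex of a cube is the unique minimum of a linear functional
(`exists_stringForm_lt`). A shift by `wirePoint` then makes one path form negative and leaves all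
others nonnegative.

When the `λ`-inequalities are added, the witnesses for paths are scaled towards the origin, where
all `λ`-forms are positive. Conversely, when the jumps of `x` are the coefficients of `λ` in reverse
order, `wirePoint i x` annihilates all `λ`-forms (`lambdaForm_wirePoint`) while the string forms
stay positive; a small move in a direction changing a single `λ`-form violates that one alone. -/

namespace StringPolytope

/-! ### Facets of finite affine systems -/

section Polyhedra

variable {d : ℕ} {ι : Type*}
variable {ρ : ι → (Fin d → ℝ) → ℝ} {c : ι → ℝ} {L : ι → (Fin d → ℝ) →L[ℝ] ℝ}

lemma exists_relative_interior_point (hρ : ∀ j u, ρ j u = c j + L j u) {z : Fin d → ℝ}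
    (hz : ∀ j, 0 < ρ j z) {j : ι} {y : Fin d → ℝ} (hy : ρ j y < 0)
    (hy' : ∀ k, k ≠ j → 0 ≤ ρ k y) :
    ∃ x, ρ j x = 0 ∧ ∀ k, k ≠ j → 0 < ρ k x := by
  have hD : 0 < ρ j z - ρ j y := by linarith [hz j]
  -- The parameter at which the segment from `y` to `z` meets the hyperplane `ρ j = 0`.
  set s : ℝ := -ρ j y / (ρ j z - ρ j y) with hs
  have hs0 : 0 < s := div_pos (by linarith) hD
  have hs1 : s < 1 := by rw [hs, div_lt_one hD]; linarith [hz j]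
  have key : ∀ k, ρ k (s • z + (1 - s) • y) = s * ρ k z + (1 - s) * ρ k y := fun k => by
    simp only [hρ, map_add, map_smul, smul_eq_mul]
    ring
  refine ⟨s • z + (1 - s) • y, ?_, fun k hk => ?_⟩
  · rw [key, hs]
    field_simp
    ring
  · rw [key]
    have := mul_pos hs0 (hz k)
    have := mul_nonneg (sub_nonneg.2 hs1.le) (hy' k hk)
    linarith

variable [Finite ι]

lemma exists_pos_forall_add_smul_pos {s : ι → Prop} {a b : ι → ℝ} (ha : ∀ j, s j → 0 < a j) :
    ∃ ε : ℝ, 0 < ε ∧ ∀ j, s j → 0 < a j + ε * b j := by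
  have h : ∀ᶠ ε : ℝ in nhdsWithin 0 (Set.Ioi 0), ∀ j, s j → 0 < a j + ε * b j := by
    rw [Filter.eventually_all]
    intro j
    by_cases hj : s j
    · have hc : Filter.Tendsto (fun ε : ℝ => a j + ε * b j) (nhds 0) (nhds (a j + 0 * b j)) :=
        Continuous.tendsto (by fun_prop) 0
      have := hc.eventually (lt_mem_nhds (a := 0) (by simpa using ha j hj))
      filter_upwards [nhdsWithin_le_nhds this] with ε hε _ using hε
    · exact Filter.Eventually.of_forall fun ε h => absurd h hj
  obtain ⟨ε, h1, h2⟩ := (h.and self_mem_nhdsWithin).exists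
  exact ⟨ε, h2, h1⟩

lemma vectorSpan_solutionSet (hρ : ∀ j u, ρ j u = c j + L j u) {z : Fin d → ℝ}
    (hz : ∀ j, 0 < ρ j z) : vectorSpan ℝ (solutionSet ρ) = ⊤ := by
  rw [eq_top_iff]
  intro w _
  obtain ⟨ε, hε, h⟩ := exists_pos_forall_add_smul_pos (s := fun _ => True) (a := fun j => ρ j z)
    (b := fun j => L j w) fun j _ => hz j
  have h1 : z + ε • w ∈ solutionSet ρ := fun j => by
    have := h j trivial
    rw [hρ] at this ⊢
    simp only [map_add, map_smul, smul_eq_mul]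
    linarith
  have := vsub_mem_vectorSpan ℝ h1 (fun j => (hz j).le : z ∈ solutionSet ρ)
  rw [vsub_eq_sub, add_sub_cancel_left] at this
  exact (Submodule.smul_mem_iff _ hε.ne').1 this

lemma isNonRedundantExpression_of_witnesses (hρ : ∀ j u, ρ j u = c j + L j u) {z : Fin d → ℝ}
    (hz : ∀ j, 0 < ρ j z) (hy : ∀ j, ∃ y, ρ j y < 0 ∧ ∀ k, k ≠ j → 0 ≤ ρ k y) :
    IsNonRedundantExpression (solutionSet ρ) ρ where
  fullDimensional := by
    refine ⟨z, mem_interior.2 ⟨{u | ∀ j, 0 < ρ j u}, fun u hu j => (hu j).le, ?_, hz⟩⟩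
    rw [Set.ofPred_forall]
    refine isOpen_iInter_of_finite fun j => isOpen_lt continuous_const ?_
    rw [show ρ j = fun u => c j + L j u from funext (hρ j)]
    fun_prop
  defines := rfl
  nonRedundant k h := by
    obtain ⟨y, h1, h2⟩ := hy k
    have : y ∈ solutionSet ρ := h ▸ (show y ∈ {u | ∀ j, j ≠ k → 0 ≤ ρ j u} from h2)
    exact absurd (this k) (not_le.2 h1)

lemma vectorSpan_facet (hρ : ∀ j u, ρ j u = c j + L j u) {j : ι} {x : Fin d → ℝ}
    (hx : ρ j x = 0) (hx' : ∀ k, k ≠ j → 0 < ρ k x) :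
    vectorSpan ℝ {u | u ∈ solutionSet ρ ∧ ρ j u = 0} = (L j).toLinearMap.ker := by
  apply le_antisymm
  · rw [vectorSpan_def, Submodule.span_le]
    rintro _ ⟨u, hu, v, hv, rfl⟩
    have h1 := hu.2
    have h2 := hv.2
    rw [hρ] at h1 h2
    simp only [vsub_eq_sub, SetLike.mem_coe, LinearMap.mem_ker, ContinuousLinearMap.coe_coe,
      map_sub]
    linarith
  · intro w hw
    replace hw : L j w = 0 := hw
    obtain ⟨ε, hε, h⟩ := exists_pos_forall_add_smul_pos (s := fun k => k ≠ j)
      (a := fun k => ρ k x) (b := fun k => L k w) hx'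
    have hval : ∀ k, ρ k (x + ε • w) = ρ k x + ε * L k w := fun k => by
      simp only [hρ, map_add, map_smul, smul_eq_mul]
      ring
    have hj : ρ j (x + ε • w) = 0 := by rw [hval, hx, hw]; ring
    have h1 : x + ε • w ∈ {u | u ∈ solutionSet ρ ∧ ρ j u = 0} := by
      refine ⟨fun k => ?_, hj⟩
      by_cases hk : k = j
      · rw [hk, hj]
      · rw [hval]; exact (h k hk).le
    have h2 : x ∈ {u | u ∈ solutionSet ρ ∧ ρ j u = 0} := by
      refine ⟨fun k => ?_, hx⟩
      by_cases hk : k = j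
      · rw [hk, hx]
      · exact (hx' k hk).le
    have := vsub_mem_vectorSpan ℝ h1 h2
    rw [vsub_eq_sub, add_sub_cancel_left] at this
    exact (Submodule.smul_mem_iff _ hε.ne').1 this

/-- On a facet of a full-dimensional polyhedron one of the inequalities is an equality. -/
lemma IsFacet.exists_forall_eq_zero (hρ : ∀ j u, ρ j u = c j + L j u) {F : Set (Fin d → ℝ)}
    (hF : IsFacet (solutionSet ρ) F) : ∃ j, ∀ x ∈ F, ρ j x = 0 := by
  obtain ⟨hne, hex, hdim⟩ := hF
  obtain ⟨l, hl⟩ := hex hne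
  by_contra! hcon
  have hFQ : ∀ x ∈ F, x ∈ solutionSet ρ := fun x hx => by rw [hl] at hx; exact hx.1
  have hmid : ∀ x ∈ F, ∀ y ∈ F, (2⁻¹ : ℝ) • (x + y) ∈ F ∧
      ∀ j, ρ j ((2⁻¹ : ℝ) • (x + y)) = 2⁻¹ * (ρ j x + ρ j y) := by
    intro x hx y hy
    have hval : ∀ j, ρ j ((2⁻¹ : ℝ) • (x + y)) = 2⁻¹ * (ρ j x + ρ j y) := fun j => by
      simp only [hρ, map_add, map_smul, smul_eq_mul]
      ring
    refine ⟨?_, hval⟩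
    have hxQ := hFQ x hx
    have hyQ := hFQ y hy
    rw [hl] at hx hy ⊢
    refine ⟨fun j => ?_, fun w hw => ?_⟩
    · rw [hval]
      linarith [hxQ j, hyQ j]
    · simp only [map_add, map_smul, smul_eq_mul]
      linarith [hx.2 w hw, hy.2 w hw]
  -- If no inequality is tight on all of `F`, taking midpoints successively produces a point of `F`
  -- where all forms are positive.
  have hpos : ∀ s : Set ι, s.Finite → ∃ x ∈ F, ∀ j ∈ s, 0 < ρ j x := by
    intro s hs
    induction s, hs using Set.Finite.induction_on with
    | empty => exact ⟨hne.choose, hne.choose_spec, by simp⟩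
    | @insert a s _ _ ih =>
      obtain ⟨x, hx, hxs⟩ := ih
      obtain ⟨y, hy, hya⟩ := hcon a
      obtain ⟨h1, h2⟩ := hmid x hx y hy
      refine ⟨_, h1, fun j hj => ?_⟩
      rw [h2]
      rcases hj with rfl | hj
      · have := lt_of_le_of_ne (hFQ y hy j) hya.symm
        linarith [hFQ x hx j]
      · linarith [hxs j hj, hFQ y hy j]
  obtain ⟨x, hx, hxpos⟩ := hpos Set.univ Set.finite_univ
  -- The functional exposing `F` is maximal at an interior point, so it vanishes and `F` is the
  -- whole polyhedron, against its dimension.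
  have hl0 : ∀ w, l w ≤ 0 := by
    intro w
    obtain ⟨ε, hε, h⟩ := exists_pos_forall_add_smul_pos (s := fun _ => True)
      (a := fun j => ρ j x) (b := fun j => L j w) fun j _ => hxpos j trivial
    rw [hl] at hx
    have := hx.2 (x + ε • w) fun j => by
      have := h j trivial
      rw [hρ] at this ⊢
      simp only [map_add, map_smul, smul_eq_mul]
      linarith
    simp only [map_add, map_smul, smul_eq_mul] at this
    nlinarith
  have hl0' : ∀ w, l w = 0 := fun w => le_antisymm (hl0 w) (by have := hl0 (-w); simp at this; exact this)
  have : F = solutionSet ρ := by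
    rw [hl]
    ext w
    simp [hl0']
  rw [this] at hdim
  omega

/-- Each face `ρ j = 0` has a point where the other forms are positive, so its direction is the
whole kernel of `L j` and it differs from the other faces. A facet lies in one of these faces and
has the same direction by dimension; its exposing functional is then constant on that face, so the
two coincide. -/
lemma facetsCorrespond_of_witnesses (hρ : ∀ j u, ρ j u = c j + L j u) {z : Fin d → ℝ}
    (hz : ∀ j, 0 < ρ j z) (hy : ∀ j, ∃ y, ρ j y < 0 ∧ ∀ k, k ≠ j → 0 ≤ ρ k y) :
    FacetsCorrespond (solutionSet ρ) ρ := by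
  have hx : ∀ j, ∃ x, ρ j x = 0 ∧ ∀ k, k ≠ j → 0 < ρ k x := fun j => by
    obtain ⟨y, h1, h2⟩ := hy j
    exact exists_relative_interior_point hρ hz h1 h2
  have hspan : ∀ j, vectorSpan ℝ {u | u ∈ solutionSet ρ ∧ ρ j u = 0} = (L j).toLinearMap.ker :=
    fun j => by
      obtain ⟨x, h1, h2⟩ := hx j
      exact vectorSpan_facet hρ h1 h2
  have hdim : ∀ j, Module.finrank ℝ (L j).toLinearMap.ker + 1 =
      Module.finrank ℝ (vectorSpan ℝ (solutionSet ρ)) := fun j => by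
    rw [vectorSpan_solutionSet hρ hz, finrank_top]
    apply Module.Dual.finrank_ker_add_one_of_ne_zero
    intro h0
    obtain ⟨y, h1, -⟩ := hy j
    have h2 := hz j
    have h3 : ∀ w, L j w = 0 := fun w => LinearMap.congr_fun h0 w
    rw [hρ, h3] at h1 h2
    linarith
  have hmem : ∀ j x, ρ j x = 0 → (∀ k, k ≠ j → 0 < ρ k x) → x ∈ solutionSet ρ := by
    intro j x h1 h2 k
    by_cases hk : k = j
    · rw [hk, h1]
    · exact (h2 k hk).le
  refine ⟨fun j _ => ⟨?_, ?_, ?_⟩, ?_, ?_⟩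
  · obtain ⟨x, h1, h2⟩ := hx j
    exact ⟨x, hmem j x h1 h2, h1⟩
  · intro _
    obtain ⟨x, h1, h2⟩ := hx j
    refine ⟨-L j, Set.ext fun u => ⟨fun hu => ⟨hu.1, fun v hv => ?_⟩,
      fun hu => ⟨hu.1, le_antisymm ?_ (hu.1 j)⟩⟩⟩
    · have h3 := hv j
      have h4 := hu.2
      rw [hρ] at h3 h4
      simp only [neg_apply]
      linarith
    · have h3 := hu.2 x (hmem j x h1 h2)
      rw [hρ] at h1 ⊢
      simp only [neg_apply] at h3
      linarith
  · rw [hspan]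
    exact hdim j
  · intro j _ k _ hjk
    obtain ⟨x, h1, h2⟩ := hx j
    have : x ∈ {u | u ∈ solutionSet ρ ∧ ρ k u = 0} := by
      change {u | u ∈ solutionSet ρ ∧ ρ j u = 0} = {u | u ∈ solutionSet ρ ∧ ρ k u = 0} at hjk
      rw [← hjk]
      exact ⟨hmem j x h1 h2, h1⟩
    by_contra hne
    exact (h2 k (Ne.symm hne)).ne' this.2
  · intro F hF
    obtain ⟨j, hj⟩ := IsFacet.exists_forall_eq_zero hρ hF
    obtain ⟨hne, hex, hFdim⟩ := hF
    obtain ⟨l, hl⟩ := hex hne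
    have hsub : F ⊆ {u | u ∈ solutionSet ρ ∧ ρ j u = 0} := fun x hx =>
      ⟨by rw [hl] at hx; exact hx.1, hj x hx⟩
    have hker : vectorSpan ℝ F = (L j).toLinearMap.ker := by
      apply Submodule.eq_of_le_of_finrank_eq
      · rw [← hspan j]
        exact vectorSpan_mono ℝ hsub
      · have := hdim j
        omega
    have hconst : vectorSpan ℝ F ≤ l.toLinearMap.ker := by
      rw [vectorSpan_def, Submodule.span_le]
      rintro _ ⟨u, hu, v, hv, rfl⟩
      rw [hl] at hu hv
      have h1 := hu.2 v hv.1
      have h2 := hv.2 u hu.1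
      simp only [vsub_eq_sub, SetLike.mem_coe, LinearMap.mem_ker, ContinuousLinearMap.coe_coe,
        map_sub]
      linarith
    refine ⟨j, trivial, Set.Subset.antisymm (fun y hyj => ?_) hsub⟩
    obtain ⟨x, hxF⟩ := hne
    have h1 : y - x ∈ (L j).toLinearMap.ker := by
      rw [← hspan j]
      exact vsub_mem_vectorSpan ℝ hyj (hsub hxF)
    rw [← hker] at h1
    have h2 : l (y - x) = 0 := hconst h1
    rw [map_sub, sub_eq_zero] at h2
    rw [hl] at hxF ⊢
    exact ⟨hyj.1, fun w hw => h2 ▸ hxF.2 w hw⟩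

end Polyhedra


/-! ### Crossings in the wiring diagram of a reduced word -/

section Wiring

variable {n : ℕ} {i : Word n}

/-- The wire that is on the left just above the node `t_j`. -/
def leftWire (i : Word n) (j : Fin (n * (n + 1) / 2)) : Fin (n + 1) :=
  prefixPerm i j (i j).castSucc

/-- The wire that is on the right just above the node `t_j`. -/
def rightWire (i : Word n) (j : Fin (n * (n + 1) / 2)) : Fin (n + 1) :=
  prefixPerm i j (i j).succ

lemma prefixPerm_zero (i : Word n) : prefixPerm i 0 = 1 := by simp [prefixPerm]

lemma prefixPerm_succ (i : Word n) (j : Fin (n * (n + 1) / 2)) :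
    prefixPerm i (j + 1) = prefixPerm i j * simpleTransposition (i j) := by
  unfold prefixPerm
  rw [List.prod_take_succ _ _ (by simp)]
  simp

lemma prefixPerm_length (hi : i ∈ reducedWords n) :
    prefixPerm i (n * (n + 1) / 2) = Fin.revPerm := by
  rw [prefixPerm, List.take_of_length_le (by simp)]
  exact hi

lemma leftWire_ne_rightWire (i : Word n) (j : Fin (n * (n + 1) / 2)) :
    leftWire i j ≠ rightWire i j := by
  intro h
  exact (Fin.castSucc_lt_succ (i := i j)).ne ((prefixPerm i j).injective h)

lemma simpleTransposition_lt {c : Fin n} {p q : Fin (n + 1)} (hpq : p < q)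
    (h : ¬ (p = c.castSucc ∧ q = c.succ)) :
    simpleTransposition c p < simpleTransposition c q := by
  simp only [simpleTransposition, Equiv.swap_apply_def]
  rw [Fin.lt_def] at hpq ⊢
  simp only [Fin.ext_iff, Fin.val_castSucc, Fin.val_succ] at h ⊢
  split_ifs <;> (try simp only [Fin.val_castSucc, Fin.val_succ]) <;> omega

/-- Two wires that do not cross in the first `m` nodes are still in increasing order. -/
lemma prefixPerm_symm_lt {a b : Fin (n + 1)} (hab : a < b) (m : ℕ) (hm : m ≤ n * (n + 1) / 2)
    (h : ∀ j : Fin (n * (n + 1) / 2), (j : ℕ) < m →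
      ¬ (a = leftWire i j ∧ b = rightWire i j)) :
    (prefixPerm i m).symm a < (prefixPerm i m).symm b := by
  induction m with
  | zero => rwa [prefixPerm_zero]
  | succ m ih =>
    have ih := ih (by omega) fun j hj => h j (by omega)
    have h2 := h ⟨m, by omega⟩ (by simp)
    have := prefixPerm_succ i ⟨m, by omega⟩
    simp only at this
    rw [this]
    simp only [← Equiv.Perm.inv_def, mul_inv_rev, Equiv.Perm.mul_apply] at ih ⊢
    have hinv : (simpleTransposition (i ⟨m, by omega⟩))⁻¹ = simpleTransposition (i ⟨m, by omega⟩) :=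
      Equiv.swap_inv _ _
    rw [hinv]
    refine simpleTransposition_lt ih fun hc => h2 ?_
    rw [Equiv.Perm.inv_eq_iff_eq, Equiv.Perm.inv_eq_iff_eq] at hc
    exact hc

lemma exists_crossing (hi : i ∈ reducedWords n) {a b : Fin (n + 1)} (hab : a < b) :
    ∃ j, leftWire i j = a ∧ rightWire i j = b := by
  by_contra! h
  have := prefixPerm_symm_lt (i := i) hab _ le_rfl fun j _ hc => h j hc.1.symm hc.2.symm
  rw [prefixPerm_length hi] at this
  simp only [Fin.revPerm_symm, Fin.revPerm_apply, Fin.rev_lt_rev] at this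
  exact absurd this (not_lt.2 hab.le)

/-- Counting: each of the `n (n + 1) / 2` pairs `a < b` must cross at some node with `a` on the
left, and there are only that many nodes, so every node is such a crossing. -/
lemma leftWire_lt_rightWire (hi : i ∈ reducedWords n) (j : Fin (n * (n + 1) / 2)) :
    leftWire i j < rightWire i j := by
  let T : Finset (Fin (n + 1) × Fin (n + 1)) := Finset.univ.filter fun p => p.1 < p.2
  have hT : T.card = n * (n + 1) / 2 := by
    have h1 : ∀ S : Finset (Finset (Fin (n + 1))), S = Finset.powersetCard 2 Finset.univ →
        S.card = n * (n + 1) / 2 := by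
      rintro _ rfl
      rw [Finset.card_powersetCard, Finset.card_univ, Fintype.card_fin, Nat.choose_two_right,
        Nat.add_sub_cancel, mul_comm]
    rw [← h1 (T.image fun p => {p.1, p.2}), Finset.card_image_of_injOn]
    · rintro ⟨a, b⟩ hp ⟨a', b'⟩ hq h
      simp only [T, Finset.coe_filter, Finset.mem_univ, true_and, Set.mem_ofPred_eq] at hp hq
      have ha : a ∈ ({a', b'} : Finset _) := by simp only at h; rw [← h]; simp
      have hb : b ∈ ({a', b'} : Finset _) := by simp only at h; rw [← h]; simp
      simp only [Finset.mem_insert, Finset.mem_singleton] at ha hb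
      simp only [Prod.mk.injEq]
      rcases ha with rfl | rfl <;> rcases hb with rfl | rfl
      · exact absurd hp (lt_irrefl _)
      · exact ⟨rfl, rfl⟩
      · exact absurd hp hq.not_gt
      · exact absurd hp (lt_irrefl _)
    · ext s
      simp only [T, Finset.mem_image, Finset.mem_filter, Finset.mem_univ, true_and,
        Finset.mem_powersetCard, Finset.subset_univ]
      constructor
      · rintro ⟨p, hp, rfl⟩
        exact Finset.card_pair hp.ne
      · intro hs
        obtain ⟨x, y, hxy, rfl⟩ := Finset.card_eq_two.1 hs
        rcases lt_or_gt_of_ne hxy with h | h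
        · exact ⟨(x, y), h, rfl⟩
        · exact ⟨(y, x), h, Finset.pair_comm _ _⟩
  have hsub : T ⊆ Finset.univ.image fun j => (leftWire i j, rightWire i j) := by
    rintro ⟨a, b⟩ hp
    simp only [T, Finset.mem_filter, Finset.mem_univ, true_and] at hp
    obtain ⟨j, h1, h2⟩ := exists_crossing hi hp
    simp only [Finset.mem_image, Finset.mem_univ, true_and]
    exact ⟨j, by rw [h1, h2]⟩
  have heq := Finset.eq_of_subset_of_card_le hsub (by
    rw [hT]
    exact Finset.card_image_le.trans (by simp))
  have : (leftWire i j, rightWire i j) ∈ T := by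
    rw [heq]
    exact Finset.mem_image_of_mem _ (Finset.mem_univ j)
  simpa [T] using this

lemma WireThrough.eq_or_eq {j : Fin (n * (n + 1) / 2)} {w : Fin (n + 1)} (h : WireThrough i j w) :
    w = leftWire i j ∨ w = rightWire i j := h

lemma IsLowestNode.unique {w : Fin (n + 1)} {j j' : Fin (n * (n + 1) / 2)}
    (h : IsLowestNode i w j) (h' : IsLowestNode i w j') : j = j' :=
  le_antisymm (h'.2 j h.1) (h.2 j' h'.1)

lemma IsNextNode.unique {k : Fin n} {w : Fin (n + 1)} {j j₁ j₂ : Fin (n * (n + 1) / 2)}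
    (h₁ : IsNextNode i k w j j₁) (h₂ : IsNextNode i k w j j₂) : j₁ = j₂ := by
  obtain ⟨-, h1, h1', h1''⟩ := h₁
  obtain ⟨-, h2, h2', h2''⟩ := h₂
  have e1 := h1' _ h2
  have e2 := h2' _ h1
  grind

end Wiring


/-! ### String forms of rigorous paths -/

section Paths

variable {n : ℕ} {i : Word n}

/-- The coefficient contributed by a passage: `1` for a switch to a larger wire, `-1` for a switch
to a smaller wire, and `0` if the path stays on its wire. -/
noncomputable def Passage.sign (p : Passage n) : ℝ :=
  if p.inWire < p.outWire then 1 else if p.outWire < p.inWire then -1 else 0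

lemma RigorousPath.eq_of_node_eq (P : RigorousPath i) {p q : Passage n} (hp : p ∈ P.passages)
    (hq : q ∈ P.passages) (h : p.node = q.node) : p = q :=
  List.inj_on_of_nodup_map P.node_at_most_once hp hq h

lemma stringCoeff_node (P : RigorousPath i) {p : Passage n} (hp : p ∈ P.passages) :
    stringCoeff P p.node = p.sign := by
  have h1 : ∀ r : Passage n → Prop, (∃ q ∈ P.passages, q.node = p.node ∧ r q) ↔ r p := fun r =>
    ⟨fun ⟨q, hq, hn, hr⟩ => P.eq_of_node_eq hq hp hn ▸ hr, fun hr => ⟨p, hp, rfl, hr⟩⟩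
  unfold stringCoeff Passage.sign
  simp only [h1 fun q => q.inWire < q.outWire, h1 fun q => q.outWire < q.inWire]

lemma stringCoeff_of_notMem (P : RigorousPath i) {j : Fin (n * (n + 1) / 2)}
    (hj : j ∉ P.passages.map Passage.node) : stringCoeff P j = 0 := by
  have h1 : ∀ r : Passage n → Prop, ¬ ∃ q ∈ P.passages, q.node = j ∧ r q :=
    fun r ⟨q, hq, hn, _⟩ => hj (List.mem_map.2 ⟨q, hq, hn⟩)
  unfold stringCoeff
  rw [if_neg (h1 _), if_neg (h1 _)]

lemma stringForm_eq_sum_passages (P : RigorousPath i) (t : Fin (n * (n + 1) / 2) → ℝ) :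
    stringForm i P t = (P.passages.map fun p => p.sign * t p.node).sum := by
  have h1 : (P.passages.map fun p => p.sign * t p.node) =
      (P.passages.map Passage.node).map fun j => stringCoeff P j * t j := by
    rw [List.map_map]
    exact List.map_congr_left fun p hp => by simp [stringCoeff_node P hp]
  rw [h1, ← List.sum_toFinset _ P.node_at_most_once, stringForm]
  refine (Finset.sum_subset (Finset.subset_univ _) fun j _ hj => ?_).symm
  rw [stringCoeff_of_notMem P (by simpa using hj), zero_mul]

/-- A sum of differences telescopes along a list if consecutive terms match. -/
lemma sum_map_sub_of_isChain {α : Type*} (f g : α → ℝ) {l : List α} {a b : α}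
    (hc : l.IsChain fun p q => f p = g q) (ha : a ∈ l.head?) (hb : b ∈ l.getLast?) :
    (l.map fun p => f p - g p).sum = f b - g a := by
  induction l generalizing a with
  | nil => simp at ha
  | cons x l ih =>
    simp only [List.head?_cons, Option.mem_def, Option.some.injEq] at ha
    subst ha
    cases l with
    | nil =>
      simp at hb
      subst hb
      simp
    | cons y l =>
      rw [List.isChain_cons_cons] at hc
      rw [List.map_cons, List.sum_cons, ih hc.2 rfl (by simpa using hb), hc.1]
      ring

/-- The point attached to a function `x` on the wires: its coordinate at a node is the difference
of the values of `x` on the two wires crossing there. -/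
def wirePoint (i : Word n) (x : Fin (n + 1) → ℝ) (j : Fin (n * (n + 1) / 2)) : ℝ :=
  x (rightWire i j) - x (leftWire i j)

lemma Passage.sign_mul_wirePoint (hi : i ∈ reducedWords n) {p : Passage n}
    (hin : WireThrough i p.node p.inWire) (hout : WireThrough i p.node p.outWire)
    (x : Fin (n + 1) → ℝ) : p.sign * wirePoint i x p.node = x p.outWire - x p.inWire := by
  have hlt := leftWire_lt_rightWire hi p.node
  unfold Passage.sign wirePoint
  rcases hin.eq_or_eq with h1 | h1 <;> rcases hout.eq_or_eq with h2 | h2 <;> rw [h1, h2]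
  · simp
  · simp [hlt]
  · simp [hlt, hlt.not_gt]
  · simp

/-- Each passage contributes the change of `x` from its incoming to its outgoing wire, and these
changes telescope. -/
lemma stringForm_wirePoint (hi : i ∈ reducedWords n) (P : RigorousPath i)
    (x : Fin (n + 1) → ℝ) : stringForm i P (wirePoint i x) = x P.k.succ - x P.k.castSucc := by
  obtain ⟨a, ha, ha1, -⟩ := P.starts
  obtain ⟨b, hb, hb1, -⟩ := P.ends
  rw [stringForm_eq_sum_passages, ← ha1, ← hb1,
    ← sum_map_sub_of_isChain (fun p => x p.outWire) (fun p => x p.inWire)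
      (P.oriented.imp fun p q h => by rw [h.1]) ha hb]
  congr 1
  exact List.map_congr_left fun p hp =>
    p.sign_mul_wirePoint hi (P.wires_through p hp).1 (P.wires_through p hp).2 x

open Classical in
/-- The function on the wires that is `-1` and `1` on the left and the right wire at `t_j`. -/
noncomputable def crossingFun (i : Word n) (j : Fin (n * (n + 1) / 2)) (w : Fin (n + 1)) : ℝ :=
  if w = leftWire i j then -1 else if w = rightWire i j then 1 else 0

/-- The point on which the value of a string form depends only on how the path passes `t_j`. -/
noncomputable def crossingPoint (i : Word n) (j m : Fin (n * (n + 1) / 2)) : ℝ :=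
  if m < j then wirePoint i (crossingFun i j) m else if m = j then 1 else 0

/-- The value of `crossingFun i j` on the edge on which the path arrives at a passage, if that edge
lies above `t_j`. -/
noncomputable def inValue (i : Word n) (k : Fin n) (j : Fin (n * (n + 1) / 2)) (p : Passage n) :
    ℝ :=
  open Classical in
  if p.node < j ∨ (p.node = j ∧ ¬ IsUp k p.inWire) then crossingFun i j p.inWire else 0

/-- The value of `crossingFun i j` on the edge on which the path leaves a passage, if that edge
lies above `t_j`. -/
noncomputable def outValue (i : Word n) (k : Fin n) (j : Fin (n * (n + 1) / 2)) (p : Passage n) :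
    ℝ :=
  open Classical in
  if p.node < j ∨ (p.node = j ∧ IsUp k p.outWire) then crossingFun i j p.outWire else 0

lemma crossingFun_eq_zero {j : Fin (n * (n + 1) / 2)} {w : Fin (n + 1)}
    (h : ¬ WireThrough i j w) : crossingFun i j w = 0 := by
  have h1 : ¬ (w = leftWire i j ∨ w = rightWire i j) := h
  rw [not_or] at h1
  rw [crossingFun, if_neg h1.1, if_neg h1.2]

/-- An edge of a wire through `t_j` lies entirely above or entirely below `t_j`, so both its ends
agree on which; on any other wire `crossingFun i j` vanishes. -/
lemma outValue_eq_inValue {k : Fin n} (j : Fin (n * (n + 1) / 2)) {p q : Passage n}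
    (h : p.outWire = q.inWire) (hn : IsNextNode i k p.outWire p.node q.node) :
    outValue i k j p = inValue i k j q := by
  unfold outValue inValue
  rw [← h]
  by_cases hw : WireThrough i j p.outWire
  · obtain ⟨-, -, h1, h2⟩ := hn
    have h3 := h1 j hw
    congr 1
    rw [eq_iff_iff]
    grind
  · rw [crossingFun_eq_zero hw, ite_self, ite_self]

lemma outValue_of_isLowestNode {k : Fin n} (j : Fin (n * (n + 1) / 2)) {p : Passage n}
    (h : p.outWire = k.succ) (hl : IsLowestNode i k.succ p.node) : outValue i k j p = 0 := by
  unfold outValue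
  by_cases hw : WireThrough i j p.outWire
  · have h1 := hl.2 j (h ▸ hw)
    have h2 : ¬ IsUp k p.outWire := by
      rw [h, IsUp, not_le]
      exact Fin.castSucc_lt_succ
    rw [if_neg]
    rintro (h3 | h3)
    · exact absurd h1 (not_le.2 h3)
    · exact h2 h3.2
  · rw [crossingFun_eq_zero hw, ite_self]

lemma inValue_of_isLowestNode {k : Fin n} (j : Fin (n * (n + 1) / 2)) {p : Passage n}
    (h : p.inWire = k.castSucc) (hl : IsLowestNode i k.castSucc p.node) :
    inValue i k j p = 0 := by
  unfold inValue
  by_cases hw : WireThrough i j p.inWire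
  · have h1 := hl.2 j (h ▸ hw)
    have h2 : IsUp k p.inWire := by rw [h, IsUp]
    rw [if_neg]
    rintro (h3 | h3)
    · exact absurd h1 (not_le.2 h3)
    · exact h3.2 h2
  · rw [crossingFun_eq_zero hw, ite_self]

/-- `1` if the wires crossing at `t_j` have opposite orientations in `G(i, k)`, otherwise `-1`. -/
noncomputable def orientationSign (i : Word n) (k : Fin n) (j : Fin (n * (n + 1) / 2)) : ℝ :=
  open Classical in
  if IsUp k (leftWire i j) ∧ ¬ IsUp k (rightWire i j) then 1 else -1

lemma orientationSign_mul_self (k : Fin n) (j : Fin (n * (n + 1) / 2)) :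
    orientationSign i k j * orientationSign i k j = 1 := by
  unfold orientationSign
  split_ifs <;> norm_num

/-- The defect from telescoping is concentrated at `t_j`. If the wires there have opposite
orientations, it is `1` for every passage. If both go up or both go down, it is `0` for a switch,
`-1` for the allowed way of staying on a wire, and would be `1` for the forbidden one. -/
lemma Passage.local_value (hi : i ∈ reducedWords n) {k : Fin n} {j : Fin (n * (n + 1) / 2)}
    {p : Passage n} (hin : WireThrough i p.node p.inWire) (hout : WireThrough i p.node p.outWire)
    (hf : ¬ IsForbidden i k p) :
    (p.node ≠ j → p.sign * crossingPoint i j p.node - (outValue i k j p - inValue i k j p) = 0) ∧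
    (p.node = j → (p.sign * crossingPoint i j p.node - (outValue i k j p - inValue i k j p) = 0 ∨
      p.sign * crossingPoint i j p.node - (outValue i k j p - inValue i k j p) =
        orientationSign i k j)) := by
  constructor
  · intro h
    unfold crossingPoint outValue inValue
    rcases lt_or_gt_of_ne h with h1 | h1
    · rw [if_pos h1, if_pos (Or.inl h1), if_pos (Or.inl h1), p.sign_mul_wirePoint hi hin hout]
      ring
    · rw [if_neg h1.not_gt, if_neg h, if_neg, if_neg]
      · ring
      · rintro (h2 | h2)
        · exact h1.not_gt h2
        · exact h h2.1
      · rintro (h2 | h2)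
        · exact h1.not_gt h2
        · exact h h2.1
  · rintro rfl
    have hlt := leftWire_lt_rightWire hi p.node
    have hl : WireThrough i p.node (leftWire i p.node) := Or.inl rfl
    have hr : WireThrough i p.node (rightWire i p.node) := Or.inr rfl
    have hmono : IsUp k (rightWire i p.node) → IsUp k (leftWire i p.node) := fun h => hlt.le.trans h
    simp only [crossingPoint, outValue, inValue, orientationSign, Passage.sign, crossingFun,
      lt_irrefl, true_and, false_or, if_false, if_true]
    by_cases ul : IsUp k (leftWire i p.node) <;> by_cases ur : IsUp k (rightWire i p.node) <;>
    rcases hin.eq_or_eq with h1 | h1 <;> rcases hout.eq_or_eq with h2 | h2 <;>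
    first
    | exact absurd (hmono ur) ul
    | (rw [h1, h2]; norm_num [ul, ur, hlt, hlt.not_gt, hlt.ne, hlt.ne']; done)
    | exact absurd ⟨h1.trans h2.symm, _, hr, Or.inr (by rw [h1]; exact ⟨hlt, ul, ur⟩)⟩ hf
    | exact absurd ⟨h1.trans h2.symm, _, hl, Or.inl (by rw [h1]; exact ⟨hlt, ur, ul⟩)⟩ hf

/-- Both ends of the path are lower ends of wires, where the truncated values vanish, so only the
defect at `t_j` remains, and `t_j` is visited at most once. -/
lemma stringForm_crossingPoint (hi : i ∈ reducedWords n) (P : RigorousPath i)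
    (j : Fin (n * (n + 1) / 2)) :
    stringForm i P (crossingPoint i j) = 0 ∨
      stringForm i P (crossingPoint i j) = orientationSign i P.k j := by
  obtain ⟨a, ha, ha1, ha2⟩ := P.starts
  obtain ⟨b, hb, hb1, hb2⟩ := P.ends
  have hc := sum_map_sub_of_isChain (outValue i P.k j) (inValue i P.k j)
    (P.oriented.imp fun p q h => outValue_eq_inValue j h.1 h.2) ha hb
  rw [outValue_of_isLowestNode j hb1 hb2, inValue_of_isLowestNode j ha1 ha2, sub_zero] at hc
  set f : Passage n → ℝ := fun p =>
    p.sign * crossingPoint i j p.node - (outValue i P.k j p - inValue i P.k j p) with hf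
  have hloc := fun p hp => Passage.local_value (p := p) hi (k := P.k) (j := j) (P.wires_through p hp).1
    (P.wires_through p hp).2 (P.no_forbidden p hp)
  have hsum : stringForm i P (crossingPoint i j) = (P.passages.map f).sum := by
    rw [stringForm_eq_sum_passages, ← add_zero (P.passages.map f).sum, ← hc, ← List.sum_map_add]
    simp only [hf, sub_add_cancel]
  rw [hsum]
  have hgen : ∀ l : List (Passage n), (∀ p ∈ l, p ∈ P.passages) → (l.map Passage.node).Nodup →
      (l.map f).sum = 0 ∨ (l.map f).sum = orientationSign i P.k j := by
    intro l
    induction l with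
    | nil => simp
    | cons p l ih =>
      intro hl hnd
      rw [List.map_cons, List.nodup_cons] at hnd
      rw [List.map_cons, List.sum_cons]
      by_cases hp : p.node = j
      · have h0 : (l.map f).sum = 0 := List.sum_eq_zero fun x hx => by
          obtain ⟨q, hq, rfl⟩ := List.mem_map.1 hx
          refine (hloc q (hl q (by simp [hq]))).1 fun hqj => hnd.1 ?_
          rw [hp, ← hqj]
          exact List.mem_map_of_mem hq
        rw [h0, add_zero]
        exact (hloc p (hl p (by simp))).2 hp
      · rw [show f p = 0 from (hloc p (hl p (by simp))).1 hp, zero_add]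
        exact ih (fun q hq => hl q (by simp [hq])) hnd.2
  exact hgen _ (fun _ h => h) P.node_at_most_once

/-- The crossing points form a unitriangular system, so they determine the coefficients. -/
lemma stringCoeff_eq_of_crossingPoint {P Q : RigorousPath i}
    (h : ∀ j, stringForm i P (crossingPoint i j) = stringForm i Q (crossingPoint i j)) :
    stringCoeff P = stringCoeff Q := by
  funext j
  induction j using WellFoundedLT.induction with
  | ind j ih =>
    have h1 := sub_eq_zero.2 (h j)
    unfold stringForm at h1
    rw [← Finset.sum_sub_distrib, Finset.sum_eq_single j] at h1
    · simpa [crossingPoint, sub_eq_zero] using h1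
    · intro m _ hm
      rcases lt_or_gt_of_ne hm with h2 | h2
      · rw [ih m h2, sub_self]
      · simp [crossingPoint, h2.not_gt, hm]
    · simp

lemma Passage.eq_of_sign_eq {p q : Passage n} (hpin : WireThrough i p.node p.inWire)
    (hp : WireThrough i p.node p.outWire)
    (hq : WireThrough i q.node q.outWire) (hn : p.node = q.node) (hin : p.inWire = q.inWire)
    (hs : p.sign = q.sign) : p = q := by
  have hout : p.outWire = q.outWire := by
    unfold Passage.sign at hs
    rw [← hn] at hq
    have := leftWire_ne_rightWire i p.node
    have h0 := hpin.eq_or_eq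
    have h1 := hp.eq_or_eq
    have h2 := hq.eq_or_eq
    rw [← hin] at hs
    by_contra hne
    have h3 : p.outWire = p.inWire ∨ q.outWire = p.inWire := by grind
    rcases h3 with h3 | h3
    · have h4 : q.outWire ≠ p.inWire := fun h => hne (h3.trans h.symm)
      rcases lt_or_gt_of_ne h4 with h5 | h5 <;> simp [h3, h5, h5.not_gt] at hs
    · have h4 : p.outWire ≠ p.inWire := fun h => hne (h.trans h3.symm)
      rcases lt_or_gt_of_ne h4 with h5 | h5 <;> simp [h3, h5, h5.not_gt] at hs
  cases p
  cases q
  simp_all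

lemma IsLowestNode.not_isNextNode {k : Fin n} {j j' : Fin (n * (n + 1) / 2)}
    (h : IsLowestNode i k.succ j) : ¬ IsNextNode i k k.succ j j' := by
  rintro ⟨-, h1, -, h2 | h2⟩
  · exact absurd h2.1 (not_le.2 Fin.castSucc_lt_succ)
  · exact absurd (h.2 j' h1) (not_le.2 h2.2)

/-- The path is reconstructed step by step: the incoming wire and the coefficient at a node give the
outgoing wire, and the orientation gives the next node. Neither path can continue after the other
has ended, since nothing follows the lowest node of a downward wire. -/
lemma passages_eq_of_coeff_eq {P Q : RigorousPath i} (hk : P.k = Q.k)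
    (hc : stringCoeff P = stringCoeff Q) {l l' : List (Passage n)} (hl : l <:+ P.passages)
    (hl' : l' <:+ Q.passages) {p p' : Passage n} (hp : p ∈ l.head?) (hp' : p' ∈ l'.head?)
    (hn : p.node = p'.node) (hw : p.inWire = p'.inWire) : l = l' := by
  induction l generalizing l' p p' with
  | nil => simp at hp
  | cons x l ih =>
    cases l' with
    | nil => simp at hp'
    | cons x' l' =>
      simp only [List.head?_cons, Option.mem_def, Option.some.injEq] at hp hp'
      subst hp hp'
      have hxP : x ∈ P.passages := hl.subset (by simp)
      have hxQ : x' ∈ Q.passages := hl'.subset (by simp)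
      have hx : x = x' := by
        refine Passage.eq_of_sign_eq (P.wires_through x hxP).1 (P.wires_through x hxP).2
          (Q.wires_through x' hxQ).2 hn hw ?_
        rw [← stringCoeff_node P hxP, ← stringCoeff_node Q hxQ, hc, hn]
      subst hx
      have hch := P.oriented.suffix hl
      have hch' := Q.oriented.suffix hl'
      obtain ⟨e, he, he1, he2⟩ := P.ends
      obtain ⟨e', he', he1', he2'⟩ := Q.ends
      rw [← hk] at hch' he1' he2'
      have hlast : ∀ R : List (Passage n), [x] <:+ R → R.getLast? = some x := by
        rintro R ⟨s, rfl⟩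
        simp
      cases l with
      | nil =>
        cases l' with
        | nil => rfl
        | cons y l' =>
          rw [Option.mem_def, hlast _ hl, Option.some.injEq] at he
          subst he
          rw [List.isChain_cons_cons, he1] at hch'
          exact absurd hch'.1.2 he2.not_isNextNode
      | cons y l =>
        cases l' with
        | nil =>
          rw [Option.mem_def, hlast _ hl', Option.some.injEq] at he'
          subst he'
          rw [List.isChain_cons_cons, he1'] at hch
          exact absurd hch.1.2 he2'.not_isNextNode
        | cons y' l' =>
          rw [List.isChain_cons_cons] at hch hch'
          rw [ih (p := y) (p' := y') ((List.suffix_cons _ _).trans hl)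
            ((List.suffix_cons _ _).trans hl') rfl rfl (hch.1.2.unique hch'.1.2)
            (hch.1.1.symm.trans hch'.1.1)]

/-- A rigorous path is determined by its orientation and its string inequality. -/
lemma RigorousPath.eq_of_coeff_eq {P Q : RigorousPath i} (hk : P.k = Q.k)
    (hc : stringCoeff P = stringCoeff Q) : P = Q := by
  obtain ⟨a, ha, ha1, ha2⟩ := P.starts
  obtain ⟨b, hb, hb1, hb2⟩ := Q.starts
  rw [← hk] at hb1 hb2
  exact RigorousPath.ext hk (passages_eq_of_coeff_eq hk hc List.suffix_rfl List.suffix_rfl ha hb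
    (ha2.unique hb2) (ha1.trans hb1.symm))

lemma abs_stringCoeff_le (P : RigorousPath i) (j : Fin (n * (n + 1) / 2)) :
    |stringCoeff P j| ≤ 1 := by
  unfold stringCoeff
  split_ifs <;> norm_num

instance : Finite (RigorousPath i) := by
  have hfin : (Set.univ.pi fun _ : Fin (n * (n + 1) / 2) => ({1, -1, 0} : Set ℝ)).Finite :=
    Set.Finite.pi fun _ => by simp
  have := hfin.to_subtype
  refine Finite.of_injective (β := Fin n × (Set.univ.pi fun _ : Fin (n * (n + 1) / 2) =>
    ({1, -1, 0} : Set ℝ))) (fun P => (P.k, ⟨stringCoeff P, fun j _ => ?_⟩)) fun P Q h => ?_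
  · unfold stringCoeff
    split_ifs <;> simp
  · rw [Prod.mk.injEq] at h
    exact RigorousPath.eq_of_coeff_eq h.1 (congrArg Subtype.val h.2)

/-- The string form as a linear map. -/
noncomputable def stringLinear (P : RigorousPath i) : (Fin (n * (n + 1) / 2) → ℝ) →L[ℝ] ℝ :=
  ∑ j, stringCoeff P j • ContinuousLinearMap.proj j

lemma stringLinear_apply (P : RigorousPath i) (t : Fin (n * (n + 1) / 2) → ℝ) :
    stringLinear P t = stringForm i P t := by
  simp [stringLinear, stringForm]

lemma stringForm_add (P : RigorousPath i) (s t : Fin (n * (n + 1) / 2) → ℝ) :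
    stringForm i P (s + t) = stringForm i P s + stringForm i P t := by
  simp only [← stringLinear_apply, map_add]

lemma stringForm_smul (P : RigorousPath i) (r : ℝ) (t : Fin (n * (n + 1) / 2) → ℝ) :
    stringForm i P (r • t) = r * stringForm i P t := by
  simp only [← stringLinear_apply, map_smul, smul_eq_mul]

lemma exists_stringForm_lt (hi : i ∈ reducedWords n) (P : RigorousPath i) :
    ∃ t, ∀ Q : RigorousPath i, Q ≠ P → Q.k = P.k →
      stringForm i P t + 1 ≤ stringForm i Q t := by
  set g : RigorousPath i → Fin (n * (n + 1) / 2) → ℝ :=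
    fun Q j => stringForm i Q (crossingPoint i j) with hg
  set κ := orientationSign i P.k with hκ
  -- The weight is `κ j` if `g P j = 0` and `-κ j` if `g P j = κ j`, so every `j` at which `Q`
  -- differs from `P` raises the form by exactly `1`.
  refine ⟨∑ j, (κ j - 2 * g P j) • crossingPoint i j, fun Q hQ hk => ?_⟩
  have hval : ∀ R : RigorousPath i,
      stringForm i R (∑ j, (κ j - 2 * g P j) • crossingPoint i j) =
        ∑ j, (κ j - 2 * g P j) * g R j := fun R => by
    simp only [← stringLinear_apply, map_sum, map_smul, smul_eq_mul, hg]
  have hP : ∀ j, g P j = 0 ∨ g P j = κ j := stringForm_crossingPoint hi P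
  have hQ' : ∀ j, g Q j = 0 ∨ g Q j = κ j := fun j => by
    rw [hκ, ← hk]
    exact stringForm_crossingPoint hi Q j
  have hdiff : ∀ j, 0 ≤ (κ j - 2 * g P j) * (g Q j - g P j) ∧
      (g Q j ≠ g P j → (κ j - 2 * g P j) * (g Q j - g P j) = 1) := fun j => by
    have h1 : κ j * κ j = 1 := orientationSign_mul_self _ _
    rcases hP j with h2 | h2 <;> rcases hQ' j with h3 | h3 <;> rw [h2, h3] <;>
      constructor <;> first | (intro h; exact absurd rfl h) | intros; nlinarith
  obtain ⟨j, hj⟩ : ∃ j, g Q j ≠ g P j := by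
    by_contra! hcon
    exact hQ (RigorousPath.eq_of_coeff_eq hk (stringCoeff_eq_of_crossingPoint hcon))
  have h1 := Finset.single_le_sum (f := fun j => (κ j - 2 * g P j) * (g Q j - g P j))
    (fun j _ => (hdiff j).1) (Finset.mem_univ j)
  simp only [(hdiff j).2 hj, mul_sub, Finset.sum_sub_distrib] at h1
  rw [hval, hval]
  linarith

lemma abs_stringForm_le (P : RigorousPath i) (t : Fin (n * (n + 1) / 2) → ℝ) :
    |stringForm i P t| ≤ ∑ j, |t j| := by
  refine (Finset.abs_sum_le_sum_abs _ _).trans (Finset.sum_le_sum fun j _ => ?_)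
  rw [abs_mul]
  exact mul_le_of_le_one_left (abs_nonneg _) (abs_stringCoeff_le P j)

lemma exists_wire_potential (D : Fin n → ℝ) :
    ∃ x : Fin (n + 1) → ℝ, ∀ k, x k.succ - x k.castSucc = D k := by
  refine ⟨fun w => ∑ c ∈ Finset.univ.filter fun c : Fin n => c.castSucc < w, D c, fun k => ?_⟩
  have : (Finset.univ.filter fun c : Fin n => c.castSucc < k.succ) =
      insert k (Finset.univ.filter fun c : Fin n => c.castSucc < k.castSucc) := by
    ext c
    simp only [Finset.mem_filter, Finset.mem_univ, true_and, Finset.mem_insert, Fin.lt_def,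
      Fin.ext_iff, Fin.val_castSucc, Fin.val_succ]
    omega
  simp only [this]
  rw [Finset.sum_insert (by simp)]
  ring

/-- A point violating the string inequality of `P` alone. -/
lemma exists_stringForm_neg (hi : i ∈ reducedWords n) (P : RigorousPath i) :
    ∃ t, stringForm i P t < 0 ∧ ∀ Q : RigorousPath i, Q ≠ P → 0 ≤ stringForm i Q t := by
  obtain ⟨t, ht⟩ := exists_stringForm_lt hi P
  -- With these jumps `P` gets the value `-1/2`, the other paths with the same `k` at least `1/2`;
  -- for other `k` the jump dominates any string form at `t`, as its coefficients are at most `1` in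
  -- absolute value.
  obtain ⟨x, hx⟩ := exists_wire_potential fun k =>
    if k = P.k then -stringForm i P t - 1 / 2 else ∑ j, |t j|
  refine ⟨t + wirePoint i x, ?_, fun Q hQ => ?_⟩
  · rw [stringForm_add, stringForm_wirePoint hi, hx, if_pos rfl]
    linarith
  · rw [stringForm_add, stringForm_wirePoint hi, hx]
    split_ifs with h
    · linarith [ht Q hQ h]
    · linarith [neg_abs_le (stringForm i Q t), abs_stringForm_le Q t]

end Paths


/-! ### The `λ`-inequalities -/

section Lambda

variable {n : ℕ} {i : Word n}

/-- Minus the Cartan integer of two columns. -/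
def columnCoeff {n : ℕ} (c c' : Fin n) : ℝ :=
  if c' = c then -2 else if (c' : ℕ) + 1 = c ∨ (c : ℕ) + 1 = c' then 1 else 0

/-- The formula for a simple reflection, paired with a simple root. -/
lemma sub_simpleTransposition (y : Fin (n + 1) → ℝ) (c c' : Fin n) :
    y (simpleTransposition c' c.castSucc) - y (simpleTransposition c' c.succ) +
      columnCoeff c c' * (y (simpleTransposition c' c'.castSucc) -
        y (simpleTransposition c' c'.succ)) = y c.castSucc - y c.succ := by
  have e1 : simpleTransposition c' c'.castSucc = c'.succ := Equiv.swap_apply_left _ _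
  have e2 : simpleTransposition c' c'.succ = c'.castSucc := Equiv.swap_apply_right _ _
  rw [e1, e2]
  unfold columnCoeff
  have hs : ∀ w : Fin (n + 1), (w : ℕ) ≠ c' → (w : ℕ) ≠ c' + 1 → simpleTransposition c' w = w :=
    fun w h1 h2 => Equiv.swap_apply_of_ne_of_ne (by simpa [Fin.ext_iff] using h1)
      (by simpa [Fin.ext_iff] using h2)
  split_ifs with h1 h2
  · subst h1
    rw [e1, e2]
    ring
  · rw [Fin.ext_iff] at h1
    rcases h2 with h2 | h2
    · have h3 : c'.succ = c.castSucc := by simp [Fin.ext_iff, h2]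
      rw [← h3, e2, hs c.succ (by simp; omega) (by simp; omega)]
      ring
    · have h3 : c.succ = c'.castSucc := by simp [Fin.ext_iff, h2]
      rw [h3, e1, hs c.castSucc (by simp; omega) (by simp; omega)]
      ring
  · rw [Fin.ext_iff] at h1
    rw [hs c.succ (by simp; omega) (by simp; omega),
      hs c.castSucc (by simp; omega) (by simp; omega)]
    ring

/-- Induction from the bottom of the diagram upwards. Below all nodes the wires are in reversed
order, which is why the jumps of `x` are `lam c.rev`; each further node acts by a simple reflection.
-/
lemma lam_add_sum_wirePoint (hi : i ∈ reducedWords n) {lam : Fin n → ℝ} {x : Fin (n + 1) → ℝ}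
    (hx : ∀ c : Fin n, x c.succ - x c.castSucc = lam c.rev) (d : ℕ) (m : ℕ)
    (hm : m + d = n * (n + 1) / 2) (c : Fin n) :
    lam c + ∑ k ∈ Finset.univ.filter (fun k : Fin (n * (n + 1) / 2) => m ≤ (k : ℕ)),
        columnCoeff c (i k) * wirePoint i x k =
      x (prefixPerm i m c.castSucc) - x (prefixPerm i m c.succ) := by
  induction d generalizing m with
  | zero =>
    have he : (Finset.univ.filter fun k : Fin (n * (n + 1) / 2) => m ≤ (k : ℕ)) = ∅ :=
      Finset.filter_eq_empty_iff.2 fun k _ => by have := k.2; omega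
    have := hx c.rev
    rw [Fin.rev_rev] at this
    rw [he, Finset.sum_empty, show m = n * (n + 1) / 2 by omega, prefixPerm_length hi,
      Fin.revPerm_apply, Fin.revPerm_apply, Fin.rev_castSucc, Fin.rev_succ, this, add_zero]
  | succ d ih =>
    have hlt : m < n * (n + 1) / 2 := by omega
    set j : Fin (n * (n + 1) / 2) := ⟨m, hlt⟩ with hj
    have he : (Finset.univ.filter fun k : Fin (n * (n + 1) / 2) => m ≤ (k : ℕ)) =
        insert j (Finset.univ.filter fun k : Fin (n * (n + 1) / 2) => m + 1 ≤ (k : ℕ)) := by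
      ext k
      simp only [Finset.mem_filter, Finset.mem_univ, true_and, Finset.mem_insert, Fin.ext_iff, hj]
      omega
    have h1 := ih (m + 1) (by omega)
    have h2 := prefixPerm_succ i j
    have h3 := sub_simpleTransposition (fun w => x (prefixPerm i m w)) c (i j)
    simp only [hj] at h2
    simp only [h2, Equiv.Perm.mul_apply] at h1
    rw [he, Finset.sum_insert (by simp [hj]), ← h3, ← h1]
    have h4 : wirePoint i x j = x (prefixPerm i m (simpleTransposition (i j) (i j).castSucc)) -
        x (prefixPerm i m (simpleTransposition (i j) (i j).succ)) := by
      rw [show simpleTransposition (i j) (i j).castSucc = (i j).succ from Equiv.swap_apply_left _ _,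
        show simpleTransposition (i j) (i j).succ = (i j).castSucc from Equiv.swap_apply_right _ _]
      rfl
    rw [h4]
    ring

lemma lambdaForm_wirePoint (hi : i ∈ reducedWords n) {lam : Fin n → ℝ} {x : Fin (n + 1) → ℝ}
    (hx : ∀ c : Fin n, x c.succ - x c.castSucc = lam c.rev) (j : Fin (n * (n + 1) / 2)) :
    lambdaForm i lam j (wirePoint i x) = 0 := by
  -- Just below `t_j` its two wires are already exchanged, so the difference of left and right there
  -- is the coordinate of the point at `t_j`.
  have h1 := lam_add_sum_wirePoint hi hx (n * (n + 1) / 2 - (j + 1)) (j + 1)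
    (by have := j.2; omega) (i j)
  rw [prefixPerm_succ, Equiv.Perm.mul_apply, Equiv.Perm.mul_apply,
    show simpleTransposition (i j) (i j).castSucc = (i j).succ from Equiv.swap_apply_left _ _,
    show simpleTransposition (i j) (i j).succ = (i j).castSucc from Equiv.swap_apply_right _ _] at h1
  have he : Finset.Ioi j = Finset.univ.filter fun k : Fin (n * (n + 1) / 2) => (j : ℕ) + 1 ≤ k := by
    ext k
    rw [Finset.mem_Ioi, Fin.lt_def, Finset.mem_filter, Nat.succ_le_iff]
    exact (and_iff_right (Finset.mem_univ k)).symm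
  unfold lambdaForm
  rw [he]
  exact sub_eq_zero.2 h1

/-- The linear part of a `λ`-form. -/
noncomputable def lambdaLinear (i : Word n) (j : Fin (n * (n + 1) / 2)) :
    (Fin (n * (n + 1) / 2) → ℝ) →L[ℝ] ℝ :=
  ∑ k ∈ Finset.Ioi j, lambdaCoeff i j k • ContinuousLinearMap.proj (R := ℝ) (φ := fun _ => ℝ) k -
    ContinuousLinearMap.proj j

lemma lambdaLinear_apply (i : Word n) (j : Fin (n * (n + 1) / 2))
    (t : Fin (n * (n + 1) / 2) → ℝ) :
    lambdaLinear i j t = ∑ k ∈ Finset.Ioi j, lambdaCoeff i j k * t k - t j := by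
  simp [lambdaLinear]

lemma lambdaForm_eq (i : Word n) (lam : Fin n → ℝ) (j : Fin (n * (n + 1) / 2))
    (t : Fin (n * (n + 1) / 2) → ℝ) : lambdaForm i lam j t = lam (i j) + lambdaLinear i j t := by
  rw [lambdaLinear_apply, lambdaForm]
  ring

/-- The linear parts of the `λ`-forms form a triangular system. -/
lemma exists_lambdaLinear_eq (i : Word n) (r : Fin (n * (n + 1) / 2) → ℝ) :
    ∃ v, ∀ j, lambdaLinear i j v = r j := by
  let T : (Fin (n * (n + 1) / 2) → ℝ) →ₗ[ℝ] (Fin (n * (n + 1) / 2) → ℝ) :=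
    LinearMap.pi fun j => (lambdaLinear i j).toLinearMap
  have hT : Function.Injective T := by
    rw [injective_iff_map_eq_zero]
    intro v hv
    have h0 : ∀ j, lambdaLinear i j v = 0 := fun j => congrFun hv j
    funext j
    induction j using WellFoundedGT.induction with
    | ind j ih =>
      have h1 := h0 j
      rw [lambdaLinear_apply, Finset.sum_eq_zero fun k hk => by
        rw [ih k (Finset.mem_Ioi.1 hk), Pi.zero_apply, mul_zero]] at h1
      simpa using h1
  obtain ⟨v, hv⟩ := LinearMap.injective_iff_surjective.1 hT r
  exact ⟨v, fun j => congrFun hv j⟩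

lemma stringPolytope_eq (i : Word n) (lam : Fin n → ℝ) :
    stringPolytope i lam = solutionSet (polytopeForm i lam) := by
  ext t
  simp [stringPolytope, solutionSet, polytopeForm, stringCone, lambdaCone, lambdaForm]

/-- A point on which all string forms are positive. -/
lemma exists_stringForm_pos (hi : i ∈ reducedWords n) :
    ∃ t, ∀ P : RigorousPath i, 0 < stringForm i P t := by
  obtain ⟨x, hx⟩ := exists_wire_potential fun _ : Fin n => (1 : ℝ)
  exact ⟨wirePoint i x, fun P => by rw [stringForm_wirePoint hi, hx]; exact one_pos⟩

lemma exists_pos_lambdaForm_smul_pos {lam : Fin n → ℝ} (hlam : ∀ c, 0 < lam c)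
    (t : Fin (n * (n + 1) / 2) → ℝ) :
    ∃ ε : ℝ, 0 < ε ∧ ∀ j, 0 < lambdaForm i lam j (ε • t) := by
  obtain ⟨ε, hε, h⟩ := exists_pos_forall_add_smul_pos (s := fun _ => True)
    (a := fun j => lam (i j)) (b := fun j => lambdaLinear i j t) fun j _ => hlam (i j)
  exact ⟨ε, hε, fun j => by
    rw [lambdaForm_eq, map_smul, smul_eq_mul]
    exact h j trivial⟩

/-- A point violating the `λ`-inequality of `t_j` alone. -/
lemma exists_lambdaForm_neg (hi : i ∈ reducedWords n) {lam : Fin n → ℝ} (hlam : ∀ c, 0 < lam c)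
    (j : Fin (n * (n + 1) / 2)) :
    ∃ t, lambdaForm i lam j t < 0 ∧ (∀ k, k ≠ j → 0 ≤ lambdaForm i lam k t) ∧
      ∀ P : RigorousPath i, 0 ≤ stringForm i P t := by
  obtain ⟨x, hx⟩ := exists_wire_potential fun c : Fin n => lam c.rev
  -- Moving along `v` from the common zero of the `λ`-forms lowers the form of `t_j` only; a short
  -- enough move keeps the finitely many string forms positive.
  obtain ⟨v, hv⟩ := exists_lambdaLinear_eq i fun k => if k = j then -1 else 0
  obtain ⟨ε, hε, h⟩ := exists_pos_forall_add_smul_pos (s := fun _ => True)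
    (a := fun P : RigorousPath i => stringForm i P (wirePoint i x))
    (b := fun P => stringForm i P v) fun P _ => by
      rw [stringForm_wirePoint hi, hx]
      exact hlam _
  have hval : ∀ k, lambdaForm i lam k (wirePoint i x + ε • v) = ε * if k = j then -1 else 0 :=
    fun k => by
      have h1 := lambdaForm_wirePoint hi hx k
      rw [lambdaForm_eq] at h1 ⊢
      rw [map_add, map_smul, hv, smul_eq_mul]
      linarith
  refine ⟨wirePoint i x + ε • v, ?_, fun k hk => ?_, fun P => ?_⟩
  · rw [hval, if_pos rfl]
    linarith
  · rw [hval, if_neg hk, mul_zero]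
  · rw [stringForm_add, stringForm_smul]
    exact (h P trivial).le

end Lambda

end StringPolytope

open StringPolytope in
theorem mainTheorem4 (n : ℕ) (i : StringPolytope.Word n)
    (hi : i ∈ StringPolytope.reducedWords n) :
    (StringPolytope.IsNonRedundantExpression (StringPolytope.stringCone i)
        (StringPolytope.stringForm i) ∧
      StringPolytope.FacetsCorrespond (StringPolytope.stringCone i)
        (StringPolytope.stringForm i)) ∧
    ∀ lam : Fin n → ℝ, StringPolytope.IsDominant lam → StringPolytope.IsRegular lam →
      StringPolytope.IsNonRedundantExpression (StringPolytope.stringPolytope i lam)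
        (StringPolytope.polytopeForm i lam) ∧
      StringPolytope.FacetsCorrespond (StringPolytope.stringPolytope i lam)
        (StringPolytope.polytopeForm i lam) := by
  obtain ⟨z, hz⟩ := exists_stringForm_pos hi
  refine ⟨?_, fun lam hdom hreg => ?_⟩
  · have hρ : ∀ (P : RigorousPath i) u, stringForm i P u = 0 + stringLinear P u := fun P u => by
      rw [stringLinear_apply, zero_add]
    exact ⟨isNonRedundantExpression_of_witnesses hρ hz (exists_stringForm_neg hi),
      facetsCorrespond_of_witnesses hρ hz (exists_stringForm_neg hi)⟩
  · have hlam : ∀ c, 0 < lam c := fun c => lt_of_le_of_ne (hdom c) (hreg c).symm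
    have hρ : ∀ s u, polytopeForm i lam s u =
        Sum.elim (fun _ => 0) (fun j => lam (i j)) s +
          Sum.elim (fun P : RigorousPath i => stringLinear P) (lambdaLinear i) s u := by
      rintro (P | j) u
      · exact (stringLinear_apply P u).symm.trans (zero_add _).symm
      · exact lambdaForm_eq i lam j u
    obtain ⟨ε, hε, hεz⟩ := exists_pos_lambdaForm_smul_pos (i := i) hlam z
    have hz' : ∀ s, 0 < polytopeForm i lam s (ε • z) := by
      rintro (P | j)
      · change 0 < stringForm i P (ε • z)
        rw [stringForm_smul]
        exact mul_pos hε (hz P)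
      · exact hεz j
    have hy : ∀ s, ∃ y, polytopeForm i lam s y < 0 ∧
        ∀ s', s' ≠ s → 0 ≤ polytopeForm i lam s' y := by
      rintro (P | j)
      · obtain ⟨t, h1, h2⟩ := exists_stringForm_neg hi P
        -- String forms are homogeneous, so scaling preserves their signs while the `λ`-forms become
        -- positive near the origin.
        obtain ⟨δ, hδ, h3⟩ := exists_pos_lambdaForm_smul_pos (i := i) hlam t
        refine ⟨δ • t, ?_, ?_⟩
        · change stringForm i P (δ • t) < 0
          rw [stringForm_smul]
          exact mul_neg_of_pos_of_neg hδ h1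
        · rintro (Q | j) hs
          · change 0 ≤ stringForm i Q (δ • t)
            rw [stringForm_smul]
            exact mul_nonneg hδ.le (h2 Q fun h => hs (by rw [h]))
          · exact (h3 j).le
      · obtain ⟨t, h1, h2, h3⟩ := exists_lambdaForm_neg hi hlam j
        refine ⟨t, h1, ?_⟩
        rintro (Q | k) hs
        · exact h3 Q
        · exact h2 k fun h => hs (by rw [h])
    rw [stringPolytope_eq]
    exact ⟨isNonRedundantExpression_of_witnesses hρ hz' hy,
      facetsCorrespond_of_witnesses hρ hz' hy⟩
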